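/- Let $X$ be a Peano continuum, that is, a compact, connected, locally connected metric space. Let $C^0(X)$ be the semigroup, under composition, of all continuous maps $X\to X$. Suppose that $X$ contains a free arc: there is an open set $J\subset X$, homeomorphic to $(0,1)$, whose closure $\overline J$ is homeomorphic to $[0,1]$. Suppose further that $C^0(X)$ has a subsemigroup $F$ such that $fg=gf$ for all $f,g\in F$, every $f\in F$ is an open map, and $F$ is sensitive: there is a constant $c>0$ such that for every nonempty open set $U\subset X$ there is some $f\in F$ with $\operatorname{diam} f(U)>c$. Then $X$ is an arc or a circle, that is, $X$ is homeomorphic to $[0,1]$ or to the unit circle $\mathbb S^1$ in the complex plane. -/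

import Mathlib

/-- A space is an arc if it is homeomorphic to the closed interval `[0,1]`. -/
def IsArc (X : Type*) [TopologicalSpace X] : Prop :=
  Nonempty (X ≃ₜ Set.Icc (0 : ℝ) 1)

/-- A space is a circle if it is homeomorphic to the unit circle of the complex plane. -/
def IsCircle (X : Type*) [TopologicalSpace X] : Prop :=
  Nonempty (X ≃ₜ Circle)

/-- A free open interval of `X`: an open subset homeomorphic to the open interval `(0,1)`. -/
def IsFreeOpenInterval {X : Type*} [TopologicalSpace X] (J : Set X) : Prop :=
  IsOpen J ∧ Nonempty (J ≃ₜ Set.Ioo (0 : ℝ) 1)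

/-- A free arc of `X`: the closure of a free open interval of `X`, provided that this closure
is homeomorphic to `[0,1]`. -/
def IsFreeArc {X : Type*} [TopologicalSpace X] (A : Set X) : Prop :=
  ∃ J : Set X, IsFreeOpenInterval J ∧ A = closure J ∧ IsArc A

/-- A set of continuous self-maps is a subsemigroup of `C(X, X)` under composition.
It need not contain the identity. -/
def IsCompSubsemigroup {X : Type*} [TopologicalSpace X] (F : Set C(X, X)) : Prop :=
  ∀ f ∈ F, ∀ g ∈ F, f.comp g ∈ F

/-- The members of `F` commute with each other under composition. -/
def IsCompCommutative {X : Type*} [TopologicalSpace X] (F : Set C(X, X)) : Prop :=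
  ∀ f ∈ F, ∀ g ∈ F, f.comp g = g.comp f

/-- A family `F` of continuous self-maps is sensitive: some `c > 0` is such that every nonempty
open `U` has an image `f(U)`, with `f ∈ F`, of diameter greater than `c`. -/
def IsSensitive {X : Type*} [MetricSpace X] (F : Set C(X, X)) : Prop :=
  ∃ c : ℝ, 0 < c ∧ ∀ U : Set X, IsOpen U → U.Nonempty → ∃ f ∈ F, c < Metric.diam (f '' U)

/-! An open curve is a continuous open map `ψ : ℝ → X`. It is injective on each side of every point,
so it can fail local injectivity only by folding back on itself. A shortest loop without folds has
clopen image and makes `X` a circle; a segment between consecutive folds has clopen image and makes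
`X` an arc, unless a loop appears. So an open curve with two folds suffices
(`isArc_or_isCircle_of_two_folds`).

Sensitivity yields an injective open curve `φ` each of whose open pieces is spread over all of `φ`
by a member of `F` (`exists_expanding_curve`). Commutativity then produces `h ∈ F` with `h ∘ φ` not
injective, hence a circle or a fold `m`. If `k ∈ F` carries `φ t` to `φ m` with `t > m`, then `k ∘ h
∘ φ = h ∘ k ∘ φ` folds at both `m` and `t`. -/

open Set Filter Topology

/-! ### One-sided injectivity of open curves -/

namespace OpenCurve

/-- The points near which an open curve is not injective. -/
def folds {X : Type*} (ψ : ℝ → X) : Set ℝ := {m | ∀ N ∈ 𝓝 m, ¬ InjOn ψ N}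

theorem isClosed_folds {X : Type*} {ψ : ℝ → X} : IsClosed (folds ψ) := by
  rw [← isOpen_compl_iff, isOpen_iff_mem_nhds]
  intro m hm
  simp only [folds, mem_compl_iff, mem_ofPred_eq, not_forall, not_not] at hm
  obtain ⟨N, hN, hi⟩ := hm
  filter_upwards [eventually_mem_nhds_iff.2 hN] with x hx h
  exact h N hx hi

variable {X : Type*} [TopologicalSpace X] {ψ : ℝ → X}

/-- The frontier of the image of an open interval under an open curve lies in the image of its
endpoints. -/
theorem subset_image_Ioo [T2Space X] (hc : Continuous ψ) (ho : IsOpenMap ψ) {a b : ℝ} {S : Set X}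
    (hS : IsPreconnected S) (hne : (S ∩ ψ '' Ioo a b).Nonempty)
    (ha : ψ a ∈ S → ψ a ∈ ψ '' Ioo a b) (hb : ψ b ∈ S → ψ b ∈ ψ '' Ioo a b) :
    S ⊆ ψ '' Ioo a b := by
  refine hS.subset_left_of_subset_union (ho _ isOpen_Ioo)
    (isCompact_Icc.image hc).isClosed.isOpen_compl (v := (ψ '' Icc a b)ᶜ) ?_ ?_ hne
  · exact disjoint_compl_right.mono_left (image_mono Ioo_subset_Icc_self)
  · intro x hx
    by_cases h : x ∈ ψ '' Icc a b
    · left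
      obtain ⟨t, ht, rfl⟩ := h
      rcases eq_endpoints_or_mem_Ioo_of_mem_Icc ht with rfl | rfl | h
      · exact ha hx
      · exact hb hx
      · exact mem_image_of_mem ψ h
    · exact Or.inr h

theorem exists_Ioo_ne [T2Space X] (hc : Continuous ψ) {p : ℝ} {z : X} (h : ψ p ≠ z) :
    ∃ η > 0, ∀ t ∈ Ioo (p - η) (p + η), ψ t ≠ z := by
  have : {t | ψ t ≠ z} ∈ 𝓝 p := (isOpen_ne.preimage hc).mem_nhds h
  obtain ⟨η, h0, h1⟩ := Metric.mem_nhds_iff.1 this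
  rw [Real.ball_eq_Ioo] at h1
  exact ⟨η, h0, fun t ht => h1 ht⟩

theorem comp_neg (hc : Continuous ψ) (ho : IsOpenMap ψ) :
    Continuous (fun t => ψ (-t)) ∧ IsOpenMap (fun t => ψ (-t)) :=
  ⟨hc.comp continuous_neg, ho.comp (Homeomorph.neg ℝ).isOpenMap⟩

variable [T2Space X] [PreconnectedSpace X] [Nontrivial X]

theorem exists_right_ne (hc : Continuous ψ) (ho : IsOpenMap ψ) (p : ℝ) :
    ∃ ε > 0, ∀ t ∈ Ioo p (p + ε), ψ t ≠ ψ p := by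
  by_contra! H
  obtain ⟨z, hz⟩ := exists_ne (ψ p)
  obtain ⟨η, h0, h1⟩ := exists_Ioo_ne hc hz.symm
  obtain ⟨t, ⟨ht, ht'⟩, htp⟩ := H η h0
  obtain ⟨s, ⟨hs, hs'⟩, hsp⟩ := H (t - p) (by linarith)
  have hmem : ψ p ∈ ψ '' Ioo p t := ⟨s, ⟨hs, by linarith⟩, hsp⟩
  -- Both endpoint values are attained inside, so the image of a short interval is all of `X`; but
  -- it misses `z`.
  obtain ⟨r, hr, hrz⟩ := subset_image_Ioo hc ho isPreconnected_univ ⟨_, mem_univ _, hmem⟩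
    (fun _ => hmem) (fun _ => htp ▸ hmem) (mem_univ z)
  exact h1 r ⟨by linarith [hr.1], by linarith [hr.2]⟩ hrz

theorem exists_left_ne (hc : Continuous ψ) (ho : IsOpenMap ψ) (p : ℝ) :
    ∃ ε > 0, ∀ t ∈ Ioo (p - ε) p, ψ t ≠ ψ p := by
  obtain ⟨hc', ho'⟩ := comp_neg hc ho
  obtain ⟨ε, h0, h⟩ := exists_right_ne hc' ho' (-p)
  refine ⟨ε, h0, fun t ht => ?_⟩
  simpa using h (-t) ⟨by linarith [ht.2], by linarith [ht.1]⟩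

theorem exists_injOn_Ico (hc : Continuous ψ) (ho : IsOpenMap ψ) (p : ℝ) :
    ∃ η > 0, InjOn ψ (Ico p (p + η)) := by
  by_contra! H
  obtain ⟨ε, e0, he⟩ := exists_right_ne hc ho p
  have key : ∀ η > 0, ∃ z w, p < z ∧ z < w ∧ w < p + η ∧ w < p + ε ∧ ψ z = ψ w := by
    intro η h0
    have h := H (min η ε) (lt_min h0 e0)
    simp only [InjOn, not_forall] at h
    obtain ⟨x, hx, y, hy, hxy, hne⟩ := h
    have h1 := min_le_left η ε
    have h2 := min_le_right η ε
    wlog hlt : x < y generalizing x y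
    · exact this y hy x hx hxy.symm (Ne.symm hne) (lt_of_le_of_ne (not_lt.1 hlt) (Ne.symm hne))
    refine ⟨x, y, lt_of_le_of_ne hx.1 ?_, hlt, by linarith [hy.2], by linarith [hy.2], hxy⟩
    rintro rfl
    exact he y ⟨hlt, by linarith [hy.2]⟩ hxy.symm
  obtain ⟨z, w, hz, hzw, -, hw, e⟩ := key 1 one_pos
  obtain ⟨η, h0, hη⟩ := exists_Ioo_ne hc (he w ⟨hz.trans hzw, hw⟩).symm
  obtain ⟨z', w', hz', hzw', hw', -, e'⟩ := key (min η (w - p)) (lt_min h0 (by linarith))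
  have h1 := min_le_left η (w - p)
  have h2 := min_le_right η (w - p)
  have hS := subset_image_Ioo hc ho (a := p) (b := w') (S := ψ '' Ioo p w)
    (isPreconnected_Ioo.image _ hc.continuousOn)
    ⟨ψ z', ⟨z', ⟨hz', by linarith⟩, rfl⟩, ⟨z', ⟨hz', hzw'⟩, rfl⟩⟩
    (fun ⟨t, ht, h⟩ => absurd h (he t ⟨ht.1, ht.2.trans hw⟩)) (fun _ => ⟨z', ⟨hz', hzw'⟩, e'⟩)
  obtain ⟨r, hr, hrw⟩ := hS ⟨z, ⟨hz, hzw⟩, e⟩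
  exact hη r ⟨by linarith [hr.1], by linarith [hr.2]⟩ hrw

theorem exists_injOn_Ioc (hc : Continuous ψ) (ho : IsOpenMap ψ) (p : ℝ) :
    ∃ η > 0, InjOn ψ (Ioc (p - η) p) := by
  obtain ⟨hc', ho'⟩ := comp_neg hc ho
  obtain ⟨ε, h0, h⟩ := exists_injOn_Ico hc' ho' (-p)
  refine ⟨ε, h0, fun t ht s hs hts => ?_⟩
  exact neg_injective (h (x₁ := -t) (x₂ := -s) ⟨by linarith [ht.2], by linarith [ht.1]⟩
    ⟨by linarith [hs.2], by linarith [hs.1]⟩ (by simpa using hts))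

end OpenCurve

/-! ### Loops give circles, pairs of folds give arcs -/

namespace OpenCurve

variable {X : Type*} [TopologicalSpace X] {ψ : ℝ → X}
variable [T2Space X] [PreconnectedSpace X] [Nontrivial X]

theorem isCircle_of_loop (hc : Continuous ψ) (ho : IsOpenMap ψ) {u v : ℝ} (huv : u < v)
    (e : ψ u = ψ v) (hi : InjOn ψ (Ico u v)) : IsCircle X := by
  obtain ⟨ε, e0, he⟩ := exists_left_ne hc ho u
  have hu : ∀ t ∈ Ioo u v, ψ t ≠ ψ u := fun t ht h =>
    ht.1.ne' (hi ⟨ht.1.le, ht.2⟩ ⟨le_rfl, huv⟩ h)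
  -- Openness at `u` makes values near `ψ v` recur near `u`; injectivity on the loop forces this to
  -- happen left of `u`. The left branch is then trapped in the loop.
  have hne : ∃ s ∈ Ioo u v, ∃ r ∈ Ioo (u - ε) u, ψ r = ψ s := by
    set w := (u + v) / 2 with hw
    have hN : ψ '' Ioo (u - ε) w ∈ 𝓝 (ψ v) :=
      (ho _ isOpen_Ioo).mem_nhds ⟨u, ⟨by linarith, by linarith⟩, e⟩
    obtain ⟨η, h0, hη⟩ := Metric.mem_nhds_iff.1 (hc.continuousAt.preimage_mem_nhds hN)
    rw [Real.ball_eq_Ioo] at hη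
    obtain ⟨s, hs, hs'⟩ := exists_between (show max w (v - η) < v from max_lt (by linarith)
      (by linarith))
    rw [max_lt_iff] at hs
    obtain ⟨r, hr, hrs⟩ := hη ⟨hs.2, by linarith⟩
    refine ⟨s, ⟨by linarith [hs.1], hs'⟩, r, ⟨hr.1, ?_⟩, hrs⟩
    by_contra! h
    have := hi ⟨h, by linarith [hr.2]⟩ ⟨by linarith [hs.1], hs'⟩ hrs
    linarith [hr.2, hs.1]
  obtain ⟨s, hs, r, hr, hrs⟩ := hne
  have hsub : ψ '' Ioo (u - ε) u ⊆ ψ '' Ioo u v :=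
    subset_image_Ioo hc ho (isPreconnected_Ioo.image _ hc.continuousOn)
      ⟨ψ s, ⟨r, hr, hrs⟩, ⟨s, hs, rfl⟩⟩ (fun ⟨t, ht, h⟩ => absurd h (he t ht))
      (fun ⟨t, ht, h⟩ => absurd (h.trans e.symm) (he t ht))
  have hIcc : ψ '' Icc u v = ψ '' Ico u v := by
    refine (image_subset_iff.2 fun t ht => ?_).antisymm (image_mono Ico_subset_Icc_self)
    rcases ht.2.eq_or_lt with rfl | h
    · exact ⟨u, ⟨le_rfl, huv⟩, e⟩
    · exact ⟨t, ⟨ht.1, h⟩, rfl⟩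
  have hIoo : ψ '' Ioo (u - ε) v = ψ '' Ico u v := by
    refine (image_subset_iff.2 fun t ht => ?_).antisymm
      (image_mono fun t ht => ⟨by linarith [ht.1], ht.2⟩)
    rcases lt_or_ge t u with h | h
    · exact image_mono Ioo_subset_Ico_self (hsub ⟨t, ⟨ht.1, h⟩, rfl⟩)
    · exact ⟨t, ⟨h, ht.2⟩, rfl⟩
  have huniv : ψ '' Ico u v = univ :=
    IsClopen.eq_univ ⟨hIcc ▸ (isCompact_Icc.image hc).isClosed, hIoo ▸ ho _ isOpen_Ioo⟩
      ⟨_, u, ⟨le_rfl, huv⟩, rfl⟩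
  have hp : 0 < v - u := sub_pos.2 huv
  have : Fact (0 < v - u) := ⟨hp⟩
  have hv : u + (v - u) = v := by ring
  have hg : Continuous (AddCircle.liftIco (v - u) u ψ) :=
    AddCircle.liftIco_continuous (by rw [hv, e]) hc.continuousOn
  have hinj : Function.Injective (AddCircle.liftIco (v - u) u ψ) := by
    have : InjOn ψ (Ico u (u + (v - u))) := by rwa [hv]
    exact this.injective.comp (AddCircle.equivIco (v - u) u).injective
  have hsurj : Function.Surjective (AddCircle.liftIco (v - u) u ψ) := by
    intro x
    obtain ⟨t, ht, rfl⟩ : x ∈ ψ '' Ico u v := huniv ▸ mem_univ x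
    exact ⟨t, AddCircle.liftIco_coe_apply (by rwa [hv])⟩
  exact ⟨((Continuous.homeoOfEquivCompactToT2 (f := Equiv.ofBijective _ ⟨hinj, hsurj⟩) hg).symm.trans
    (AddCircle.homeomorphCircle hp.ne'))⟩

/-- Local injectivity keeps double pairs away from the diagonal, so they form a compact set; one of
least length bounds a simple loop. -/
theorem injOn_Icc_or_isCircle (hc : Continuous ψ) (ho : IsOpenMap ψ) {a b : ℝ}
    (h : ∀ x ∈ Icc a b, ∃ N ∈ 𝓝 x, InjOn ψ (N ∩ Icc a b)) :
    InjOn ψ (Icc a b) ∨ IsCircle X := by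
  by_contra! H
  obtain ⟨hinj, hcirc⟩ := H
  let T : Set (ℝ × ℝ) := {q | q ∈ Icc a b ×ˢ Icc a b ∧ q.1 < q.2 ∧ ψ q.1 = ψ q.2}
  have hTne : T.Nonempty := by
    simp only [InjOn, not_forall] at hinj
    obtain ⟨x, hx, y, hy, hxy, hne⟩ := hinj
    rcases lt_or_gt_of_ne hne with h | h
    · exact ⟨(x, y), ⟨hx, hy⟩, h, hxy⟩
    · exact ⟨(y, x), ⟨hy, hx⟩, h, hxy.symm⟩
  have hTcl : IsClosed T := by
    refine isClosed_of_closure_subset fun q hq => ?_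
    have hq' : q ∈ {q : ℝ × ℝ | q ∈ Icc a b ×ˢ Icc a b ∧ q.1 ≤ q.2 ∧ ψ q.1 = ψ q.2} := by
      refine closure_minimal (by rintro q ⟨h1, h2, h3⟩; exact ⟨h1, h2.le, h3⟩) ?_ hq
      exact (isClosed_Icc.prod isClosed_Icc).inter ((isClosed_le continuous_fst continuous_snd).inter
        (isClosed_eq (hc.comp continuous_fst) (hc.comp continuous_snd)))
    refine ⟨hq'.1, lt_of_le_of_ne hq'.2.1 fun hdiag => ?_, hq'.2.2⟩
    obtain ⟨N, hN, hNi⟩ := h q.1 hq'.1.1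
    have hNN : N ×ˢ N ∈ 𝓝 q := by
      rw [← Prod.mk.eta (p := q), ← hdiag]
      exact prod_mem_nhds hN hN
    obtain ⟨r, hrN, hrT⟩ := mem_closure_iff_nhds.1 hq _ hNN
    exact hrT.2.1.ne (hNi ⟨hrN.1, hrT.1.1⟩ ⟨hrN.2, hrT.1.2⟩ hrT.2.2)
  have hTc : IsCompact T := (isCompact_Icc.prod isCompact_Icc).of_isClosed_subset hTcl fun q hq => hq.1
  obtain ⟨⟨u, v⟩, ⟨⟨hu, hv⟩, huv, e⟩, hmin⟩ :=
    hTc.exists_isMinOn hTne (f := fun q => q.2 - q.1) (by fun_prop)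
  refine hcirc (isCircle_of_loop hc ho huv e ?_)
  have key : ∀ x ∈ Ico u v, ∀ y ∈ Ico u v, ψ x = ψ y → ¬ x < y := by
    intro x hx y hy hxy hlt
    have := isMinOn_iff.1 hmin (x, y) ⟨⟨⟨hu.1.trans hx.1, hx.2.le.trans hv.2⟩,
      ⟨hu.1.trans hy.1, hy.2.le.trans hv.2⟩⟩, hlt, hxy⟩
    dsimp only at this
    linarith [hx.1, hy.2]
  intro x hx y hy hxy
  exact le_antisymm (not_lt.1 (key y hy x hx hxy.symm)) (not_lt.1 (key x hx y hy hxy))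

theorem injective_or_exists_fold_or_isCircle (hc : Continuous ψ) (ho : IsOpenMap ψ) :
    Function.Injective ψ ∨ (folds ψ).Nonempty ∨ IsCircle X := by
  by_contra! H
  obtain ⟨hinj, hf, hcirc⟩ := H
  refine hinj fun x y hxy => ?_
  refine ((injOn_Icc_or_isCircle hc ho (a := min x y) (b := max x y) fun p _ => ?_).resolve_right
    hcirc) ⟨min_le_left _ _, le_max_left _ _⟩ ⟨min_le_right _ _, le_max_right _ _⟩ hxy
  have : p ∉ folds ψ := hf ▸ notMem_empty p
  simp only [folds, mem_ofPred_eq, not_forall, not_not] at this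
  obtain ⟨N, hN, hi⟩ := this
  exact ⟨N, hN, hi.mono inter_subset_left⟩

/-- Both sides of `m` are injective, so a coincidence near `m` pairs the two sides. The left branch
thus meets the right one, and can leave it only through `ψ m` or `ψ t`, which it avoids. -/
theorem exists_image_Ioc_subset_of_fold (hc : Continuous ψ) (ho : IsOpenMap ψ) {m t : ℝ}
    (hmt : m < t) (hm : m ∈ folds ψ) (hi : InjOn ψ (Icc m t)) :
    ∃ r < m, ψ '' Ioc r m ⊆ ψ '' Icc m t := by
  have hne : ψ m ≠ ψ t := fun h => hmt.ne (hi ⟨le_rfl, hmt.le⟩ ⟨hmt.le, le_rfl⟩ h)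
  obtain ⟨η, h0, hη⟩ := exists_Ioo_ne hc hne
  obtain ⟨δ, d0, hδ⟩ := exists_injOn_Ioc hc ho m
  obtain ⟨ε, e0, he⟩ := exists_between (show 0 < min (min η δ) (t - m) from
    lt_min (lt_min h0 d0) (sub_pos.2 hmt))
  simp only [lt_min_iff] at he
  have hN := hm (Ioo (m - ε) (m + ε)) (Ioo_mem_nhds (by linarith) (by linarith))
  simp only [InjOn, not_forall] at hN
  obtain ⟨x, hx, y, hy, hxy, hxne⟩ := hN
  wlog hlt : x < y generalizing x y
  · exact this y hy x hx hxy.symm (Ne.symm hxne) (lt_of_le_of_ne (not_lt.1 hlt) (Ne.symm hxne))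
  have hxm : x < m := by
    by_contra! h
    exact hxne (hi ⟨h, by linarith [hx.2]⟩ ⟨h.trans hlt.le, by linarith [hy.2]⟩ hxy)
  have hym : m < y := by
    by_contra! h
    exact hxne (hδ ⟨by linarith [hx.1], hxm.le⟩ ⟨by linarith [hy.1], h⟩ hxy)
  have hsub : ψ '' Ico x m ⊆ ψ '' Ioo m t := by
    refine subset_image_Ioo hc ho (isPreconnected_Ico.image _ hc.continuousOn)
      ⟨ψ x, ⟨x, ⟨le_rfl, hxm⟩, rfl⟩, ⟨y, ⟨hym, by linarith [hy.2]⟩, hxy.symm⟩⟩ ?_ ?_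
    · rintro ⟨s, hs, h⟩
      exact absurd (hδ ⟨by linarith [hs.1, hx.1], hs.2.le⟩ ⟨by linarith, le_rfl⟩ h) hs.2.ne
    · rintro ⟨s, hs, h⟩
      exact absurd h (hη s ⟨by linarith [hs.1, hx.1], by linarith [hs.2]⟩)
  refine ⟨x, hxm, image_subset_iff.2 fun s hs => ?_⟩
  rcases hs.2.eq_or_lt with rfl | h
  · exact ⟨s, ⟨le_rfl, hmt.le⟩, rfl⟩
  · exact image_mono Ioo_subset_Icc_self (hsub ⟨s, ⟨hs.1.le, h⟩, rfl⟩)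

theorem exists_image_Ico_subset_of_fold (hc : Continuous ψ) (ho : IsOpenMap ψ) {m t : ℝ}
    (hmt : m < t) (ht : t ∈ folds ψ) (hi : InjOn ψ (Icc m t)) :
    ∃ r > t, ψ '' Ico t r ⊆ ψ '' Icc m t := by
  obtain ⟨hc', ho'⟩ := comp_neg hc ho
  have hf : -t ∈ folds fun s => ψ (-s) := by
    intro N hN h
    refine ht ((fun s => -s) ⁻¹' N) (continuous_neg.continuousAt.preimage_mem_nhds hN) ?_
    intro x hx y hy hxy
    exact neg_injective (h hx hy (by simpa using hxy))
  obtain ⟨r, hr, hsub⟩ := exists_image_Ioc_subset_of_fold hc' ho' (neg_lt_neg hmt) hf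
    (fun x hx y hy hxy => neg_injective (hi ⟨by linarith [hx.2], by linarith [hx.1]⟩
      ⟨by linarith [hy.2], by linarith [hy.1]⟩ hxy))
  refine ⟨-r, by linarith, image_subset_iff.2 fun s hs => ?_⟩
  obtain ⟨q, hq, e⟩ := hsub ⟨-s, ⟨by linarith [hs.2], by linarith [hs.1]⟩, rfl⟩
  exact ⟨-q, ⟨by linarith [hq.2], by linarith [hq.1]⟩, by simpa using e⟩

theorem isArc_of_injOn_of_folds (hc : Continuous ψ) (ho : IsOpenMap ψ) {m t : ℝ} (hmt : m < t)
    (hm : m ∈ folds ψ) (ht : t ∈ folds ψ) (hi : InjOn ψ (Icc m t)) : IsArc X := by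
  obtain ⟨r, hr, hl⟩ := exists_image_Ioc_subset_of_fold hc ho hmt hm hi
  obtain ⟨r', hr', hr''⟩ := exists_image_Ico_subset_of_fold hc ho hmt ht hi
  have hIoo : ψ '' Ioo r r' = ψ '' Icc m t := by
    refine (image_subset_iff.2 fun s hs => ?_).antisymm
      (image_mono fun s hs => ⟨by linarith [hs.1], by linarith [hs.2]⟩)
    rcases le_or_gt s m with h | h
    · exact hl ⟨s, ⟨hs.1, h⟩, rfl⟩
    rcases le_or_gt t s with h' | h'
    · exact hr'' ⟨s, ⟨h', hs.2⟩, rfl⟩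
    · exact ⟨s, ⟨h.le, h'.le⟩, rfl⟩
  have huniv : ψ '' Icc m t = univ :=
    IsClopen.eq_univ ⟨(isCompact_Icc.image hc).isClosed, hIoo ▸ ho _ isOpen_Ioo⟩
      ⟨_, m, ⟨le_rfl, hmt.le⟩, rfl⟩
  have hsurj : Function.Surjective ((Icc m t).domRestrict ψ) := by
    intro x
    obtain ⟨s, hs, rfl⟩ : x ∈ ψ '' Icc m t := huniv ▸ mem_univ x
    exact ⟨⟨s, hs⟩, rfl⟩
  exact ⟨(Continuous.homeoOfEquivCompactToT2
    (f := Equiv.ofBijective ((Icc m t).domRestrict ψ) ⟨hi.injective, hsurj⟩)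
    hc.continuousOn.domRestrict).symm.trans (iccHomeoI m t hmt)⟩

theorem isArc_or_isCircle_of_two_folds (hc : Continuous ψ) (ho : IsOpenMap ψ) {m t : ℝ}
    (hmt : m < t) (hm : m ∈ folds ψ) (ht : t ∈ folds ψ) : IsArc X ∨ IsCircle X := by
  obtain ⟨η, h0, hη⟩ := exists_injOn_Ico hc ho m
  have hnf : ∀ s ∈ Ioo m (m + η), s ∉ folds ψ := fun s hs h =>
    h _ (Ioo_mem_nhds hs.1 hs.2) (hη.mono Ioo_subset_Ico_self)
  have hge : ∀ s, m < s → s ∈ folds ψ → m + η ≤ s := fun s hs h => by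
    by_contra! hlt
    exact hnf s ⟨hs, hlt⟩ h
  -- `q` is the next fold after `m`.
  obtain ⟨q, ⟨hqI, hqf⟩, hqmin⟩ := (isCompact_Icc.inter_right (isClosed_folds (ψ := ψ))).exists_isLeast
    ⟨t, ⟨hge t hmt ht, le_rfl⟩, ht⟩
  have hmq : m < q := by linarith [hqI.1]
  refine (injOn_Icc_or_isCircle hc ho (a := m) (b := q) fun x hx => ?_).imp_left
    (isArc_of_injOn_of_folds hc ho hmq hm hqf)
  rcases eq_endpoints_or_mem_Ioo_of_mem_Icc hx with rfl | rfl | hx'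
  · exact ⟨Iio (x + η), Iio_mem_nhds (by linarith), hη.mono (by rintro s ⟨h1, h2⟩; exact ⟨h2.1, h1⟩)⟩
  · obtain ⟨δ, d0, hδ⟩ := exists_injOn_Ioc hc ho x
    exact ⟨Ioi (x - δ), Ioi_mem_nhds (by linarith), hδ.mono (by rintro s ⟨h1, h2⟩; exact ⟨h1, h2.2⟩)⟩
  · have hxf : x ∉ folds ψ := fun h =>
      (hqmin ⟨⟨hge x hx'.1 h, hx'.2.le.trans hqI.2⟩, h⟩).not_gt hx'.2
    simp only [folds, mem_ofPred_eq, not_forall, not_not] at hxf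
    obtain ⟨N, hN, hi⟩ := hxf
    exact ⟨N, hN, hi.mono inter_subset_left⟩

end OpenCurve

theorem exists_isOpenMap_range_eq_Ioo {a b : ℝ} (hab : a < b) :
    ∃ θ : ℝ → ℝ, Continuous θ ∧ IsOpenMap θ ∧ Function.Injective θ ∧ range θ = Ioo a b := by
  have hmono : StrictMono fun x => a + (b - a) * Real.sigmoid x := fun x y h => by
    have := mul_lt_mul_of_pos_left (Real.sigmoid_lt h) (sub_pos.2 hab)
    dsimp only
    linarith
  have hrange : (range fun x => a + (b - a) * Real.sigmoid x) = Ioo a b := by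
    have : (fun x => a + (b - a) * Real.sigmoid x)
        = (fun y => (b - a) * y + a) ∘ Real.sigmoid := by
      ext x
      simp [add_comm]
    rw [this, range_comp, Real.range_sigmoid, image_affine_Ioo (sub_pos.2 hab)]
    simp
  have hord : OrdConnected (range fun x => a + (b - a) * Real.sigmoid x) :=
    hrange ▸ ordConnected_Ioo
  have hemb : IsOpenEmbedding fun x => a + (b - a) * Real.sigmoid x :=
    ⟨hmono.isEmbedding_of_ordConnected hord, hrange ▸ isOpen_Ioo⟩
  exact ⟨_, hemb.continuous, hemb.isOpenMap, hemb.injective, hrange⟩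

theorem Finset.exists_recurrent {ι : Type*} {S : Finset ι} (hS : S.Nonempty) {r : ι → ι → Prop}
    (htrans : ∀ i j k, r i j → r j k → r i k) (hr : ∀ i ∈ S, ∃ j ∈ S, r i j) :
    ∃ i ∈ S, ∀ j ∈ S, r i j → r j i := by
  classical
  obtain ⟨i, hi, hmin⟩ := S.exists_min_image (fun i => (S.filter (r i)).card) hS
  obtain ⟨k, hk, hik⟩ := hr i hi
  have key : ∀ j ∈ S, r i j → S.filter (r j) = S.filter (r i) := fun j hj hij =>
    Finset.eq_of_subset_of_card_le
      (Finset.monotone_filter_right S fun l _ hl => htrans i j l hij hl) (hmin j hj)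
  refine ⟨k, hk, fun j hj hkj => ?_⟩
  have : k ∈ S.filter (r j) := by
    rw [key j hj (htrans i k j hik hkj)]
    exact Finset.mem_filter.2 ⟨hk, hik⟩
  exact (Finset.mem_filter.1 this).2

/-! ### From sensitivity to an expanding curve -/

namespace OpenCurve

theorem exists_injective_subcurve {X : Type*} [TopologicalSpace X] [T2Space X]
    [PreconnectedSpace X] [Nontrivial X] {ψ : ℝ → X} (hc : Continuous ψ) (ho : IsOpenMap ψ)
    {U : Set X} (hU : IsOpen U) (hne : (U ∩ range ψ).Nonempty) :
    ∃ φ : ℝ → X, Continuous φ ∧ IsOpenMap φ ∧ Function.Injective φ ∧ range φ ⊆ U := by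
  obtain ⟨_, hpU, p, rfl⟩ := hne
  obtain ⟨η, h0, hη⟩ := exists_injOn_Ico hc ho p
  obtain ⟨ε, e0, he⟩ := Metric.mem_nhds_iff.1 (hc.continuousAt.preimage_mem_nhds (hU.mem_nhds hpU))
  rw [Real.ball_eq_Ioo] at he
  have hm := lt_min h0 e0
  obtain ⟨θ, θc, θo, θi, θr⟩ := exists_isOpenMap_range_eq_Ioo (show p < p + min η ε by linarith)
  have hθ : ∀ x, θ x ∈ Ioo p (p + min η ε) := fun x => θr ▸ mem_range_self x
  have h1 := min_le_left η ε
  have h2 := min_le_right η ε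
  refine ⟨ψ ∘ θ, hc.comp θc, ho.comp θo, fun x y hxy => θi (hη ?_ ?_ hxy), ?_⟩
  · exact ⟨(hθ x).1.le, by linarith [(hθ x).2]⟩
  · exact ⟨(hθ y).1.le, by linarith [(hθ y).2]⟩
  · rintro _ ⟨x, rfl⟩
    exact he ⟨by linarith [(hθ x).1], by linarith [(hθ x).2]⟩

variable {X : Type*} [MetricSpace X] [CompactSpace X] [LocallyConnectedSpace X]

/-- Midway along a long curve, a small connected neighbourhood misses both ends, hence lies in the
image. Compactness makes `δ` uniform. -/
theorem exists_ball_subset_range {c : ℝ} (c0 : 0 < c) :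
    ∃ δ > 0, ∀ ψ : ℝ → X, Continuous ψ → IsOpenMap ψ → c < Metric.diam (range ψ) →
      ∃ x, Metric.ball x δ ⊆ range ψ := by
  have hV (x : X) := locallyConnectedSpace_iff_subsets_isOpen_isConnected.1 ‹_› x _
    (Metric.ball_mem_nhds x (show 0 < c / 4 by positivity))
  choose V hVb hVo hxV hVc using hV
  obtain ⟨δ, d0, hδ⟩ := lebesgue_number_lemma_of_metric isCompact_univ hVo
    fun x _ => mem_iUnion.2 ⟨x, hxV x⟩
  refine ⟨δ, d0, fun ψ hc ho hdiam => ?_⟩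
  obtain ⟨u, v, huv⟩ : ∃ u v, c < dist (ψ u) (ψ v) := by
    by_contra! H
    refine hdiam.not_ge (Metric.diam_le_of_forall_dist_le c0.le ?_)
    rintro _ ⟨u, rfl⟩ _ ⟨v, rfl⟩
    exact H u v
  wlog hlt : u < v generalizing u v
  · refine this v u (by rwa [dist_comm]) (lt_of_le_of_ne (not_lt.1 hlt) ?_)
    rintro rfl
    rw [dist_self] at huv
    exact c0.not_gt huv
  obtain ⟨w, hw, hwd⟩ := intermediate_value_Ioo hlt.le
    (f := fun t => dist (ψ u) (ψ t)) (by fun_prop)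
    (show c / 2 ∈ Ioo _ _ from ⟨by rw [dist_self]; positivity, by linarith⟩)
  dsimp only at hwd
  have htri := dist_triangle (ψ u) (ψ w) (ψ v)
  obtain ⟨x, hx⟩ := hδ (ψ w) (mem_univ _)
  have hw' : ψ w ∈ V x := hx (Metric.mem_ball_self d0)
  have hfar : ∀ y ∈ V x, dist (ψ w) y < c / 2 := fun y hy => by
    have h1 := Metric.mem_ball'.1 (hVb x hw')
    have h2 := Metric.mem_ball.1 (hVb x hy)
    have h3 := dist_triangle (ψ w) x y
    rw [dist_comm x (ψ w)] at h1
    rw [dist_comm y x] at h2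
    linarith
  refine ⟨ψ w, hx.trans ((subset_image_Ioo hc ho (hVc x).isPreconnected
    ⟨_, hw', w, hw, rfl⟩ (fun h => ?_) (fun h => ?_)).trans (image_subset_range _ _))⟩
  · have := hfar _ h
    rw [dist_comm] at this
    linarith
  · have := hfar _ h
    linarith

/-- Finitely many balls cover `X`. Every open piece of a curve can be blown up over one of them, so
some ball is recurrent: whatever ball it reaches can be mapped back over it. -/
theorem exists_expanding_curve [ConnectedSpace X] [Nontrivial X] {F : Set C(X, X)}
    (hsemi : IsCompSubsemigroup F) (hopen : ∀ f ∈ F, IsOpenMap f) (hsens : IsSensitive F)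
    {ψ₀ : ℝ → X} (hc₀ : Continuous ψ₀) (ho₀ : IsOpenMap ψ₀) :
    ∃ φ : ℝ → X, Continuous φ ∧ IsOpenMap φ ∧ Function.Injective φ ∧
      ∀ U, IsOpen U → U.Nonempty → U ⊆ range φ → ∃ f ∈ F, range φ ⊆ f '' U := by
  classical
  obtain ⟨c, c0, hsens⟩ := hsens
  obtain ⟨δ, d0, hδ⟩ := exists_ball_subset_range (X := X) c0
  have d2 : 0 < δ / 2 := half_pos d0
  obtain ⟨T, hT⟩ := isCompact_univ.elim_finite_subcover (fun z : X => Metric.ball z (δ / 2))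
    (fun _ => Metric.isOpen_ball) fun z _ => mem_iUnion.2 ⟨z, Metric.mem_ball_self d2⟩
  let S := T.filter fun z => ∃ ψ : ℝ → X, Continuous ψ ∧ IsOpenMap ψ ∧
    Metric.ball z (δ / 2) ⊆ range ψ
  have step : ∀ ψ : ℝ → X, Continuous ψ → IsOpenMap ψ → ∀ U, IsOpen U → (U ∩ range ψ).Nonempty →
      ∃ f ∈ F, ∃ z ∈ S, Metric.ball z (δ / 2) ⊆ f '' U := by
    intro ψ hc ho U hU hne
    obtain ⟨φ, φc, φo, -, φU⟩ := exists_injective_subcurve hc ho hU hne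
    obtain ⟨f, hf, hfd⟩ := hsens (range φ) φo.isOpen_range (range_nonempty φ)
    have hfc : Continuous (f ∘ φ) := f.continuous.comp φc
    have hfo : IsOpenMap (f ∘ φ) := (hopen f hf).comp φo
    rw [← range_comp] at hfd
    obtain ⟨x, hx⟩ := hδ _ hfc hfo hfd
    obtain ⟨z, hzT, hz⟩ := mem_iUnion₂.1 (hT (mem_univ x))
    have hzx : Metric.ball z (δ / 2) ⊆ range (f ∘ φ) := by
      refine Subset.trans (Metric.ball_subset_ball' ?_) hx
      linarith [Metric.mem_ball'.1 hz]
    refine ⟨f, hf, z, Finset.mem_filter.2 ⟨hzT, _, hfc, hfo, hzx⟩, hzx.trans ?_⟩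
    rw [range_comp]
    exact image_mono φU
  have stepS : ∀ z ∈ S, ∀ U, IsOpen U → U.Nonempty → U ⊆ Metric.ball z (δ / 2) →
      ∃ f ∈ F, ∃ z' ∈ S, Metric.ball z' (δ / 2) ⊆ f '' U := by
    intro z hz U hU hne hUz
    obtain ⟨-, ψ, hc, ho, hψ⟩ := Finset.mem_filter.1 hz
    refine step ψ hc ho U hU ?_
    rwa [inter_eq_left.2 (hUz.trans hψ)]
  have hSne : S.Nonempty := by
    obtain ⟨f, -, z, hz, -⟩ := step ψ₀ hc₀ ho₀ univ isOpen_univ ⟨ψ₀ 0, mem_univ _, 0, rfl⟩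
    exact ⟨z, hz⟩
  obtain ⟨z, hz, hrec⟩ := Finset.exists_recurrent hSne
    (r := fun z z' => ∃ f ∈ F, Metric.ball z' (δ / 2) ⊆ f '' Metric.ball z (δ / 2))
    (by
      rintro i j k ⟨f, hf, hij⟩ ⟨g, hg, hjk⟩
      refine ⟨g.comp f, hsemi g hg f hf, hjk.trans ?_⟩
      rw [ContinuousMap.coe_comp, image_comp]
      exact image_mono hij)
    (fun i hi => by
      obtain ⟨f, hf, j, hj, hij⟩ := stepS i hi _ Metric.isOpen_ball ⟨i, Metric.mem_ball_self d2⟩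
        Subset.rfl
      exact ⟨j, hj, f, hf, hij⟩)
  obtain ⟨-, ψ, hc, ho, hψ⟩ := Finset.mem_filter.1 hz
  have hzψ : (Metric.ball z (δ / 2) ∩ range ψ).Nonempty :=
    ⟨z, Metric.mem_ball_self d2, hψ (Metric.mem_ball_self d2)⟩
  obtain ⟨φ, φc, φo, φi, φz⟩ := exists_injective_subcurve hc ho Metric.isOpen_ball hzψ
  refine ⟨φ, φc, φo, φi, fun U hU hne hUφ => ?_⟩
  obtain ⟨f, hf, z', hz', hfz⟩ := stepS z hz U hU hne (hUφ.trans φz)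
  obtain ⟨g, hg, hgz⟩ := hrec z' hz' ⟨f, hf, hfz.trans (image_mono (hUφ.trans φz))⟩
  refine ⟨g.comp f, hsemi g hg f hf, φz.trans (hgz.trans ?_)⟩
  rw [ContinuousMap.coe_comp, image_comp]
  exact image_mono hfz

end OpenCurve

/-! ### Commutativity and the conclusion -/

theorem IsFreeOpenInterval.exists_curve {X : Type*} [TopologicalSpace X] {J : Set X}
    (hJ : IsFreeOpenInterval J) : ∃ ψ : ℝ → X, Continuous ψ ∧ IsOpenMap ψ := by
  obtain ⟨hJo, ⟨e⟩⟩ := hJ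
  obtain ⟨θ, θc, θo, -, θr⟩ := exists_isOpenMap_range_eq_Ioo (zero_lt_one' ℝ)
  have hθ : ∀ x, θ x ∈ Ioo (0 : ℝ) 1 := fun x => θr ▸ mem_range_self x
  refine ⟨fun x => e.symm ⟨θ x, hθ x⟩, ?_, ?_⟩
  · exact continuous_subtype_val.comp (e.symm.continuous.comp (θc.subtype_mk hθ))
  · exact hJo.isOpenMap_subtype_val.comp (e.symm.isOpenMap.comp (θo.subtype_mk hθ))

open OpenCurve in
theorem theorem1p1 {X : Type*} [MetricSpace X] [CompactSpace X] [ConnectedSpace X]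
    [LocallyConnectedSpace X] (hX : ∃ A : Set X, IsFreeArc A)
    (F : Set C(X, X)) (hsemi : IsCompSubsemigroup F) (hcomm : IsCompCommutative F)
    (hopen : ∀ f ∈ F, IsOpenMap f) (hsens : IsSensitive F) :
    IsArc X ∨ IsCircle X := by
  have hnt : Nontrivial X := by
    by_contra h
    rw [not_nontrivial_iff_subsingleton] at h
    obtain ⟨c, c0, hs⟩ := hsens
    obtain ⟨f, -, hf⟩ := hs univ isOpen_univ univ_nonempty
    rw [Metric.diam_subsingleton (subsingleton_of_subsingleton)] at hf
    exact c0.not_gt hf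
  obtain ⟨A, J, hJ, -⟩ := hX
  obtain ⟨ψ₀, hc₀, ho₀⟩ := hJ.exists_curve
  obtain ⟨φ, φc, φo, φi, hφ⟩ := exists_expanding_curve hsemi hopen hsens hc₀ ho₀
  have hcov : ∀ V : Set ℝ, IsOpen V → V.Nonempty → ∃ f ∈ F, ∀ t, ∃ s ∈ V, f (φ s) = φ t := by
    intro V hV hne
    obtain ⟨f, hf, h⟩ := hφ (φ '' V) (φo V hV) (hne.image φ) (image_subset_range φ V)
    refine ⟨f, hf, fun t => ?_⟩
    obtain ⟨_, ⟨s, hs, rfl⟩, h⟩ := h (mem_range_self t)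
    exact ⟨s, hs, h⟩
  have hcomm' : ∀ f ∈ F, ∀ g ∈ F, ∀ x, f (g x) = g (f x) := fun f hf g hg x =>
    DFunLike.congr_fun (hcomm f hf g hg) x
  obtain ⟨f, hf, hfcov⟩ := hcov (Iio 0) isOpen_Iio ⟨-1, by simp⟩
  obtain ⟨g, hg, hgcov⟩ := hcov (Ioi 0) isOpen_Ioi ⟨1, by simp⟩
  have hhF : f.comp g ∈ F := hsemi f hf g hg
  -- The point `φ 0` is reached from `v > 0` by `g` then `f`, and from `u' < 0` by `f` then `g`.
  have hnot : ¬ Function.Injective (f.comp g ∘ φ) := by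
    intro hi
    obtain ⟨u, -, hu⟩ := hfcov 0
    obtain ⟨v, hv, hvu⟩ := hgcov u
    obtain ⟨v', -, hv'⟩ := hgcov 0
    obtain ⟨u', hu', huv'⟩ := hfcov v'
    have : v = u' := hi (by
      simp only [Function.comp_apply, ContinuousMap.comp_apply]
      rw [hvu, hu, hcomm' f hf g hg, huv', hv'])
    subst this
    exact lt_asymm (mem_Ioi.1 hv) (mem_Iio.1 hu')
  generalize f.comp g = h at hhF hnot
  rcases (injective_or_exists_fold_or_isCircle (h.continuous.comp φc)
    ((hopen h hhF).comp φo)).resolve_left hnot with ⟨m, hm⟩ | hcirc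
  swap
  · exact Or.inr hcirc
  obtain ⟨k, hk, hkcov⟩ := hcov (Ioi m) isOpen_Ioi ⟨m + 1, by simp⟩
  obtain ⟨t, ht, hkt⟩ := hkcov m
  have hkh : ∀ x, k (h x) = h (k x) := hcomm' k hk h hhF
  refine isArc_or_isCircle_of_two_folds (ψ := k ∘ h ∘ φ)
    (k.continuous.comp (h.continuous.comp φc)) ((hopen k hk).comp ((hopen h hhF).comp φo)) ht ?_ ?_
  · intro N hN hi
    exact hm N hN fun x hx y hy hxy => hi hx hy (congrArg k hxy)
  -- Near `t`, `k ∘ φ` covers a neighbourhood of `φ m`, so `h ∘ k ∘ φ` inherits the fold of `h ∘ φ`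
  -- at `m`.
  · intro N hN hi
    have himg : (k ∘ φ) '' N ∈ 𝓝 (φ m) := hkt ▸ ((hopen k hk).comp φo).image_mem_nhds hN
    refine hm _ (φc.continuousAt.preimage_mem_nhds himg) ?_
    rintro x ⟨x', hx', hx⟩ y ⟨y', hy', hy⟩ hxy
    have : x' = y' := hi hx' hy' (by
      simp only [Function.comp_apply] at hx hy hxy ⊢
      rw [hkh, hkh, hx, hy, hxy])
    subst this
    exact φi (hx.symm.trans hy)
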